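/- Let $d_A,d_B,d_C,d_D\ge 3$. In $\mathbb{C}^{d_X}$, $X\in\{A,B,C,D\}$, with computational basis $|0\rangle,\dots,|d_X-1\rangle$, put, for $s\in\mathbb{Z}_{d_X-1}=\{0,\dots,d_X-2\}$ and $w_n=e^{2\pi\sqrt{-1}/n}$, $$|\eta_s\rangle_X=\sum_{t=0}^{d_X-2}w_{d_X-1}^{st}|t\rangle_X,\qquad |\xi_s\rangle_X=\sum_{t=0}^{d_X-2}w_{d_X-1}^{st}|t+1\rangle_X .$$ Vectors and operators need not be normalized. Consider the following 16 sets of product vectors in $\mathbb{C}^{d_A}\otimes\mathbb{C}^{d_B}\otimes\mathbb{C}^{d_C}\otimes\mathbb{C}^{d_D}$, where in each set every label $i,j,k$ of a vector $|\eta\rangle_X$ or $|\xi\rangle_X$ runs independently through $\mathbb{Z}_{d_X-1}$: $$\begin{aligned} \mathcal{C}_1&=\{|\xi_i\rangle_A|\eta_j\rangle_B|0\rangle_C|\xi_k\rangle_D\}, & \mathcal{D}_1&=\{|\eta_i\rangle_A|\xi_j\rangle_B|d_C-1\rangle_C|\eta_k\rangle_D\},\\ \mathcal{C}_2&=\{|\xi_i\rangle_A|d_B-1\rangle_B|\eta_j\rangle_C|\eta_k\rangle_D\},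 & \mathcal{D}_2&=\{|\eta_i\rangle_A|0\rangle_B|\xi_j\rangle_C|\xi_k\rangle_D\},\\ \mathcal{C}_3&=\{|\xi_i\rangle_A|\xi_j\rangle_B|\xi_k\rangle_C|d_D-1\rangle_D\}, & \mathcal{D}_3&=\{|\eta_i\rangle_A|\eta_j\rangle_B|\eta_k\rangle_C|0\rangle_D\},\\ \mathcal{C}_4&=\{|\xi_i\rangle_A|d_B-1\rangle_B|0\rangle_C|d_D-1\rangle_D\}, & \mathcal{D}_4&=\{|\eta_i\rangle_A|0\rangle_B|d_C-1\rangle_C|0\rangle_D\},\\ \mathcal{C}_5&=\{|d_A-1\rangle_A|\eta_i\rangle_B|\xi_j\rangle_C|\eta_k\rangle_D\}, & \mathcal{D}_5&=\{|0\rangle_A|\xi_i\rangle_B|\eta_j\rangle_C|\xi_k\rangle_D\},\\ \mathcal{C}_6&=\{|d_A-1\rangle_A|\eta_i\rangle_B|0\rangle_C|0\rangle_D\}, & \mathcal{D}_6&=\{|0\rangle_A|\xi_i\rangle_B|d_C-1\rangle_C|d_D-1\rangle_D\},\\ \mathcal{C}_7&=\{|d_A-1\rangle_A|0\rangle_B|\xi_i\rangle_C|d_D-1\rangle_D\},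 & \mathcal{D}_7&=\{|0\rangle_A|d_B-1\rangle_B|\eta_i\rangle_C|0\rangle_D\},\\ \mathcal{C}_8&=\{|d_A-1\rangle_A|d_B-1\rangle_B|d_C-1\rangle_C|\eta_i\rangle_D\}, & \mathcal{D}_8&=\{|0\rangle_A|0\rangle_B|0\rangle_C|\xi_i\rangle_D\}. \end{aligned}$$ Let $\mathcal{S}=\bigcup_{i=1}^{8}(\mathcal{C}_i\cup\mathcal{D}_i)$. Then: (1) The 16 sets come from a decomposition of the outermost layer of a 4-dimensional hypercube. To each of them belongs a box in $\{0,\dots,d_A-1\}\times\{0,\dots,d_B-1\}\times\{0,\dots,d_C-1\}\times\{0,\dots,d_D-1\}$, obtained by replacing a factor $|c\rangle_X$ by $\{c\}$, a factor $|\eta\rangle_X$ by $\{0,\dots,d_X-2\}$, and a factor $|\xi\rangle_X$ by $\{1,\dots,d_X-1\}$. The 16 boxes are pairwise disjoint, their union is the set of points $x$ with $x_X\in\{0,d_X-1\}$ for at least one $X$, and each of the 16 sets spans the same subspace as the computational basis vectors of its box. (2) $\mathcal{S}$ is an orthogonal product set: it consists of nonzero product vectors that are pairwise orthogonal. (3)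 $\mathcal{S}$ is of the strongest nonlocality: for each bipartition of $\{A,B,C,D\}$ into two nonempty sets of parties and each of its two sides $T$, if the parties in $T$ jointly perform a measurement with operators $M_1,\dots,M_m$ on their joint space, $\sum_k M_k^\dagger M_k=\mathbb{I}$, such that for each $k$ the vectors $(M_k\otimes\mathbb{I})|\psi\rangle$, $|\psi\rangle\in\mathcal{S}$, are mutually orthogonal (an orthogonality-preserving measurement), then each POVM element $M_k^\dagger M_k$ is proportional to the identity. (4) Hence $\mathcal{S}$ is strongly nonlocal: for each such bipartition it is locally irreducible, that is, no sequence of outcomes of orthogonality-preserving local measurements by the two sides eliminates a state of $\mathcal{S}$ (maps it to zero without mapping all states of $\mathcal{S}$ to zero). (5) $|\mathcal{S}|=d_Ad_Bd_Cd_D-(d_A-2)(d_B-2)(d_C-2)(d_D-2)$. -/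

import Mathlib

open scoped BigOperators

noncomputable section

/-! ## Multipartite systems, product states, local measurements -/

namespace Multipartite

variable {ι : Type} [Fintype ι] [DecidableEq ι]

/-- Vectors of the multipartite system `⊗ᵢ ℂ^(d i)`, written in the computational basis
`|x⟩ = ⊗ᵢ |x i⟩`, with the standard inner product. -/
abbrev State (d : ι → ℕ) : Type := EuclideanSpace ℂ (∀ i, Fin (d i))

/-- Operators on the joint system `⊗_{i ∈ T} ℂ^(d i)` of the parties in `T`, as matrices in the
computational basis. -/
abbrev LocalMatrix (d : ι → ℕ) (T : Finset ι) : Type :=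
  Matrix (∀ i : T, Fin (d i)) (∀ i : T, Fin (d i)) ℂ

/-- The tensor product `⊗ᵢ |v i⟩` of local vectors. -/
def productState {d : ι → ℕ} (v : ∀ i, EuclideanSpace ℂ (Fin (d i))) : State d :=
  WithLp.toLp 2 fun x => ∏ i, v i (x i)

/-- An orthogonal product set: nonzero product vectors (not necessarily normalized) that are
pairwise orthogonal. -/
def IsOrthogonalProductSet {d : ι → ℕ} (S : Set (State d)) : Prop :=
  (∀ ψ ∈ S, ψ ≠ 0 ∧ ∃ v : ∀ i, EuclideanSpace ℂ (Fin (d i)), ψ = productState v) ∧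
    S.Pairwise fun ψ φ => inner ℂ ψ φ = 0

/-- The matrix `M ⊗ 𝟙` on the whole system: `M` on the parties in `T` and the identity on all
other parties. -/
def extend {d : ι → ℕ} {T : Finset ι} (M : LocalMatrix d T) :
    Matrix (∀ i, Fin (d i)) (∀ i, Fin (d i)) ℂ :=
  Matrix.of fun x y =>
    M (fun i => x i) (fun i => y i) * if ∀ i, i ∉ T → x i = y i then 1 else 0

/-- The operator `M ⊗ 𝟙` on the whole system. -/
def localOp {d : ι → ℕ} {T : Finset ι} (M : LocalMatrix d T) : State d →ₗ[ℂ] State d :=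
  Matrix.toEuclideanLin (extend M)

/-- A measurement of the joint party `T` with measurement operators `M k`, that is, with POVM
elements `(M k)ᴴ * M k`, which sum to the identity. -/
def IsMeasurement {d : ι → ℕ} {T : Finset ι} {m : ℕ} (M : Fin m → LocalMatrix d T) : Prop :=
  ∑ k, (M k).conjTranspose * M k = 1

/-- The (unnormalized) post-measurement states of the family `φ` are mutually orthogonal, for
every outcome. -/
def PreservesOrthogonality {d : ι → ℕ} {T : Finset ι} {m : ℕ} (M : Fin m → LocalMatrix d T)
    {κ : Type} (φ : κ → State d) : Prop :=
  ∀ k, Pairwise fun i j => inner ℂ (localOp (M k) (φ i)) (localOp (M k) (φ j)) = 0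

/-- All POVM elements are proportional to the identity. -/
def IsTrivialMeasurement {d : ι → ℕ} {T : Finset ι} {m : ℕ} (M : Fin m → LocalMatrix d T) : Prop :=
  ∀ k, ∃ c : ℂ, (M k).conjTranspose * M k = c • (1 : LocalMatrix d T)

/-- The strongest nonlocality: for every bipartition `T | Tᶜ` of the parties, only trivial
orthogonality-preserving measurements can be performed. As `T` runs over all nonempty proper
subsets of the parties, both sides of each bipartition are covered. -/
def IsStrongestNonlocal {d : ι → ℕ} (S : Set (State d)) : Prop :=
  ∀ T : Finset ι, T.Nonempty → T ≠ Finset.univ →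
    ∀ (m : ℕ) (M : Fin m → LocalMatrix d T), IsMeasurement M →
      PreservesOrthogonality M (fun ψ : S => (ψ : State d)) → IsTrivialMeasurement M

/-- `Reachable T ψ φ`: starting from the family `ψ`, the family `φ` is what is left after some
finite sequence of outcomes of orthogonality-preserving local measurements, each performed by one
of the two sides of the bipartition `T | Tᶜ` and possibly depending on the earlier outcomes. -/
inductive Reachable {d : ι → ℕ} (T : Finset ι) {κ : Type} (ψ : κ → State d) :
    (κ → State d) → Prop
  | start : Reachable T ψ ψ
  | measure {φ : κ → State d} (hφ : Reachable T ψ φ) (P : Finset ι) (hP : P = T ∨ P = Tᶜ)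
      (m : ℕ) (M : Fin m → LocalMatrix d P) (hM : IsMeasurement M)
      (hO : PreservesOrthogonality M φ) (k : Fin m) :
      Reachable T ψ fun j => localOp (M k) (φ j)

/-- Local irreducibility in the bipartition `T | Tᶜ`: no state of the set can be eliminated by
orthogonality-preserving local measurements. A state is eliminated if a sequence of outcomes maps
it to zero, while these outcomes do occur for some other state of the set. -/
def IsLocallyIrreducible {d : ι → ℕ} (T : Finset ι) (S : Set (State d)) : Prop :=
  ∀ φ : S → State d, Reachable T (fun ψ : S => (ψ : State d)) φ →
    ∀ i j, φ i = 0 → φ j = 0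

/-- Strong nonlocality: local irreducibility in every bipartition. -/
def IsStronglyNonlocal {d : ι → ℕ} (S : Set (State d)) : Prop :=
  ∀ T : Finset ι, T.Nonempty → T ≠ Finset.univ → IsLocallyIrreducible T S

/-! ## The local vectors and the blocks -/

/-- The computational basis vector `|t⟩` of `ℂ^n`, for `t < n`. -/
def ket (n t : ℕ) : EuclideanSpace ℂ (Fin n) :=
  WithLp.toLp 2 fun x => if (x : ℕ) = t then 1 else 0

/-- `w_n = exp (2πi / n)`. -/
def rootOfUnity (n : ℕ) : ℂ := Complex.exp (2 * Real.pi * Complex.I / n)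

/-- `|η_s⟩ = ∑_{t=0}^{n-2} w_{n-1}^{st} |t⟩` in `ℂ^n`. -/
def eta (n s : ℕ) : EuclideanSpace ℂ (Fin n) :=
  ∑ t ∈ Finset.range (n - 1), rootOfUnity (n - 1) ^ (s * t) • ket n t

/-- `|ξ_s⟩ = ∑_{t=0}^{n-2} w_{n-1}^{st} |t+1⟩` in `ℂ^n`. -/
def xi (n s : ℕ) : EuclideanSpace ℂ (Fin n) :=
  ∑ t ∈ Finset.range (n - 1), rootOfUnity (n - 1) ^ (s * t) • ket n (t + 1)

/-- The four kinds of tensor factors that occur in the blocks. -/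
inductive Factor
  | first
  | last
  | eta
  | xi

/-- The local vectors of each kind in `ℂ^n`: `|0⟩`; `|n-1⟩`; all `|η_s⟩`, `s ∈ ℤ_{n-1}`;
all `|ξ_s⟩`, `s ∈ ℤ_{n-1}`. -/
def Factor.vectors (n : ℕ) : Factor → Set (EuclideanSpace ℂ (Fin n))
  | .first => {ket n 0}
  | .last => {ket n (n - 1)}
  | .eta => {v | ∃ s < n - 1, v = Multipartite.eta n s}
  | .xi => {v | ∃ s < n - 1, v = Multipartite.xi n s}

/-- The coordinates on which the local vectors of each kind live: `{0}`; `{n-1}`; `{0, …, n-2}`;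
`{1, …, n-1}`. -/
def Factor.coords (n : ℕ) : Factor → Set (Fin n)
  | .first => {x | (x : ℕ) = 0}
  | .last => {x | (x : ℕ) = n - 1}
  | .eta => {x | (x : ℕ) < n - 1}
  | .xi => {x | 1 ≤ (x : ℕ)}

/-- The set of all product states with factors of the kinds `p i`, the labels of the factors
varying independently. -/
def block (d : ι → ℕ) (p : ι → Factor) : Set (State d) :=
  {ψ | ∃ v : ∀ i, EuclideanSpace ℂ (Fin (d i)), (∀ i, v i ∈ (p i).vectors (d i)) ∧
    ψ = productState v}

/-- The box of grid points of the hypercube that belongs to a block. -/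
def cell (d : ι → ℕ) (p : ι → Factor) : Set (∀ i, Fin (d i)) :=
  {x | ∀ i, x i ∈ (p i).coords (d i)}

/-- The outermost layer of the hypercube `∏ᵢ {0, …, d i - 1}`. -/
def outermostLayer (d : ι → ℕ) : Set (∀ i, Fin (d i)) :=
  {x | ∃ i, (x i : ℕ) = 0 ∨ (x i : ℕ) = d i - 1}

/-- The vectors that are linear combinations of the `|x⟩`, `x ∈ R`. -/
def basisSpan (d : ι → ℕ) (R : Set (∀ i, Fin (d i))) : Submodule ℂ (State d) :=
  Submodule.span ℂ ((fun x => EuclideanSpace.single x (1 : ℂ)) '' R)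

/-- The blocks `C₁, …, C₈`; the parties are `A = 0`, `B = 1`, `C = 2`, `D = 3`. -/
def patternC : Fin 8 → Fin 4 → Factor :=
  ![![.xi, .eta, .first, .xi],
    ![.xi, .last, .eta, .eta],
    ![.xi, .xi, .xi, .last],
    ![.xi, .last, .first, .last],
    ![.last, .eta, .xi, .eta],
    ![.last, .eta, .first, .first],
    ![.last, .first, .xi, .last],
    ![.last, .last, .last, .eta]]

/-- The blocks `D₁, …, D₈`. -/
def patternD : Fin 8 → Fin 4 → Factor :=
  ![![.eta, .xi, .last, .eta],
    ![.eta, .first, .xi, .xi],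
    ![.eta, .eta, .eta, .first],
    ![.eta, .first, .last, .first],
    ![.first, .xi, .eta, .xi],
    ![.first, .xi, .last, .last],
    ![.first, .last, .eta, .first],
    ![.first, .first, .first, .xi]]

/-- The 16 blocks: `C₁, …, C₈` (left) and `D₁, …, D₈` (right). -/
def pattern : Fin 8 ⊕ Fin 8 → Fin 4 → Factor := Sum.elim patternC patternD

/-- The union `⋃ᵢ (Cᵢ ∪ Dᵢ)` of the 16 blocks. -/
def fourPartySet (d : Fin 4 → ℕ) : Set (State d) := ⋃ b, block d (pattern b)

end Multipartite

end

/-!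
The argument runs in the computational basis, where the sixteen blocks become sixteen boxes.

*Orthogonality and spans.* In one tensor factor, the vectors of a kind are a Fourier basis of the
span of the corresponding coordinates, by the orthogonality of the characters of `ℤ / (n - 1)`.
Hence the states of a block are an orthogonal basis of the span of the points of its cell
(`span_block`). The cells partition the outermost layer; as membership in a cell depends on the
zone of each coordinate only (first, interior, last), this is a finite check. So the set is an
orthogonal basis of the span of the layer, which gives its cardinality.

*Strongest nonlocality.* Let `M` be a measurement operator of a proper subset of the parties, let
`X` be a party outside of it, and let `F` be the matrix `MᴴM ⊗ 𝟙` on the whole system. It satisfies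
`⟨ψ|F|φ⟩ = 0` for distinct states `ψ`, `φ` of the set.

* `F x y = 0` for points `x`, `y` of different cells, since the blocks span
  (`entry_eq_zero_of_cells_ne`).
* On each cell, `F` is diagonal in the Fourier basis, whose vectors vanish nowhere on the cell. If
  the row of `F` at one point of the cell is that of a scalar matrix, this determines all the
  eigenvalues, and `F` is scalar on the cell (`entry_eq_of_isolated_point`).
* `F` does not see the coordinate of `X`: being a scalar row is preserved when this coordinate
  changes. Each of the two faces perpendicular to `X` is covered by cells, so the two statements
  above propagate scalar rows from one point of a cell to the whole cell, and from there to each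
  cell whose projection along `X` overlaps it.
* On the two faces perpendicular to `X` there are two cells whose projections along `X` have
  exactly one point in common. The row there is scalar, and the overlap graph is connected
  (`exists_corner_and_connected`). So `F` is scalar (`exists_eq_smul_one`).

*Strong nonlocality.* By induction on the outcomes, the states that are left are the images of the
original ones under an operator `A ⊗ B`, where `AᴴA` and `BᴴB` are nonzero scalars, unless all of
them are zero (`eq_zero_or_exists_of_reachable`); a product of nonzero multiples of isometries
eliminates no state.
-/

namespace Multipartite

/-! ### The local vectors -/

theorem rootOfUnity_isPrimitiveRoot {m : ℕ} (hm : m ≠ 0) :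
    IsPrimitiveRoot (rootOfUnity m) m :=
  Complex.isPrimitiveRoot_exp m hm

theorem conj_rootOfUnity {m : ℕ} (hm : m ≠ 0) :
    starRingEnd ℂ (rootOfUnity m) = (rootOfUnity m)⁻¹ :=
  (Complex.inv_eq_conj ((rootOfUnity_isPrimitiveRoot hm).norm'_eq_one hm)).symm

/-- Orthogonality of the characters of `ℤ / m`. -/
theorem sum_conj_rootOfUnity_pow_mul {m s s' : ℕ} (hs : s < m) (hs' : s' < m) :
    ∑ t ∈ Finset.range m,
        starRingEnd ℂ (rootOfUnity m ^ (s * t)) * rootOfUnity m ^ (s' * t) =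
      if s = s' then (m : ℂ) else 0 := by
  have hm : m ≠ 0 := by omega
  have hw := rootOfUnity_isPrimitiveRoot hm
  have hw0 : rootOfUnity m ≠ 0 := hw.ne_zero hm
  set w := rootOfUnity m with hwdef
  have hterm : ∀ t, starRingEnd ℂ (w ^ (s * t)) * w ^ (s' * t) = ((w ^ s)⁻¹ * w ^ s') ^ t := by
    intro t
    rw [map_pow, hwdef, conj_rootOfUnity hm, ← hwdef, mul_pow, ← inv_pow, ← pow_mul, ← pow_mul]
  simp only [hterm]
  split_ifs with h
  · subst h
    simp [inv_mul_cancel₀ (pow_ne_zero s hw0)]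
  · have hz : (w ^ s)⁻¹ * w ^ s' ≠ 1 := by
      intro h1
      apply h
      apply hw.pow_inj hs hs'
      rw [inv_mul_eq_iff_eq_mul₀ (pow_ne_zero s hw0), mul_one] at h1
      exact h1.symm
    rw [geom_sum_eq hz, mul_pow, inv_pow, ← pow_mul, ← pow_mul, mul_comm s, mul_comm s', pow_mul,
      pow_mul, hw.pow_eq_one]
    simp

theorem ket_apply (n t : ℕ) (x : Fin n) : ket n t x = if (x : ℕ) = t then 1 else 0 := rfl

theorem eta_apply (n s : ℕ) (x : Fin n) :
    eta n s x = if (x : ℕ) < n - 1 then rootOfUnity (n - 1) ^ (s * x) else 0 := by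
  simp [eta, ket_apply]

theorem xi_apply (n s : ℕ) (x : Fin n) :
    xi n s x = if 1 ≤ (x : ℕ) then rootOfUnity (n - 1) ^ (s * (x - 1)) else 0 := by
  simp only [xi, WithLp.ofLp_sum, WithLp.ofLp_smul, Finset.sum_apply, Pi.smul_apply, ket_apply,
    smul_eq_mul, mul_ite, mul_one, mul_zero]
  split_ifs with h
  · rw [Finset.sum_eq_single (x - 1 : ℕ)]
    · rw [if_pos (by omega)]
    · intro t _ ht
      rw [if_neg (by omega)]
    · intro hx
      exact absurd (Finset.mem_range.2 (by omega)) hx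
  · exact Finset.sum_eq_zero fun t _ => if_neg (by omega)

theorem inner_eq_sum {α : Type} [Fintype α] (v w : EuclideanSpace ℂ α) :
    inner ℂ v w = ∑ x, starRingEnd ℂ (v x) * w x := by
  simp [PiLp.inner_apply, mul_comm]

theorem inner_eta {n s s' : ℕ} (hs : s < n - 1) (hs' : s' < n - 1) :
    inner ℂ (eta n s) (eta n s') = if s = s' then ((n - 1 : ℕ) : ℂ) else 0 := by
  obtain ⟨m, rfl⟩ : ∃ m, n = m + 1 := ⟨n - 1, by omega⟩
  rw [← sum_conj_rootOfUnity_pow_mul hs hs', inner_eq_sum]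
  simp only [eta_apply]
  rw [Fin.sum_univ_eq_sum_range (fun x => starRingEnd ℂ
    (if x < m + 1 - 1 then rootOfUnity (m + 1 - 1) ^ (s * x) else 0) *
      (if x < m + 1 - 1 then rootOfUnity (m + 1 - 1) ^ (s' * x) else 0)) (m + 1),
    Finset.sum_range_succ]
  simp only [Nat.add_sub_cancel, lt_irrefl, if_false, mul_zero, add_zero]
  refine Finset.sum_congr rfl fun t ht => ?_
  rw [if_pos (Finset.mem_range.1 ht), if_pos (Finset.mem_range.1 ht)]

theorem inner_xi {n s s' : ℕ} (hs : s < n - 1) (hs' : s' < n - 1) :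
    inner ℂ (xi n s) (xi n s') = if s = s' then ((n - 1 : ℕ) : ℂ) else 0 := by
  obtain ⟨m, rfl⟩ : ∃ m, n = m + 1 := ⟨n - 1, by omega⟩
  rw [← sum_conj_rootOfUnity_pow_mul hs hs', inner_eq_sum]
  simp only [xi_apply]
  rw [Fin.sum_univ_eq_sum_range (fun x => starRingEnd ℂ
    (if 1 ≤ x then rootOfUnity (m + 1 - 1) ^ (s * (x - 1)) else 0) *
      (if 1 ≤ x then rootOfUnity (m + 1 - 1) ^ (s' * (x - 1)) else 0)) (m + 1),
    Finset.sum_range_succ']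
  simp

theorem apply_eq_zero_of_notMem_coords {n : ℕ} {f : Factor} {v : EuclideanSpace ℂ (Fin n)}
    (hv : v ∈ f.vectors n) {x : Fin n} (hx : x ∉ f.coords n) : v x = 0 := by
  cases f
  · obtain rfl : v = ket n 0 := hv
    exact if_neg hx
  · obtain rfl : v = ket n (n - 1) := hv
    exact if_neg hx
  · obtain ⟨s, -, rfl⟩ := hv
    rw [eta_apply]
    exact if_neg hx
  · obtain ⟨s, -, rfl⟩ := hv
    rw [xi_apply]
    exact if_neg hx

theorem apply_ne_zero_of_mem_coords {n : ℕ} {f : Factor}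
    {v : EuclideanSpace ℂ (Fin n)} (hv : v ∈ f.vectors n) {x : Fin n} (hx : x ∈ f.coords n) :
    v x ≠ 0 := by
  have hw : rootOfUnity (n - 1) ≠ 0 := Complex.exp_ne_zero _
  cases f
  · obtain rfl : v = ket n 0 := hv
    refine (if_pos hx).trans_ne ?_
    exact one_ne_zero
  · obtain rfl : v = ket n (n - 1) := hv
    refine (if_pos hx).trans_ne ?_
    exact one_ne_zero
  · obtain ⟨s, -, rfl⟩ := hv
    rw [eta_apply]
    refine (if_pos hx).trans_ne ?_
    exact pow_ne_zero _ hw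
  · obtain ⟨s, -, rfl⟩ := hv
    rw [xi_apply]
    refine (if_pos hx).trans_ne ?_
    exact pow_ne_zero _ hw

theorem vectors_pairwise_orthogonal (n : ℕ) (f : Factor) :
    (f.vectors n).Pairwise fun v w => inner ℂ v w = 0 := by
  cases f
  · exact Set.pairwise_singleton _ _
  · exact Set.pairwise_singleton _ _
  · rintro _ ⟨s, hs, rfl⟩ _ ⟨s', hs', rfl⟩ hne
    rw [inner_eta hs hs', if_neg]
    rintro rfl
    exact hne rfl
  · rintro _ ⟨s, hs, rfl⟩ _ ⟨s', hs', rfl⟩ hne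
    rw [inner_xi hs hs', if_neg]
    rintro rfl
    exact hne rfl

theorem single_eq_ket {n : ℕ} (x : Fin n) : EuclideanSpace.single x (1 : ℂ) = ket n x := by
  ext y
  simp [ket_apply, Fin.ext_iff]

/-- The inverse discrete Fourier transform. -/
theorem single_mem_span_vectors {n : ℕ} {f : Factor} {x : Fin n} (hx : x ∈ f.coords n) :
    EuclideanSpace.single x (1 : ℂ) ∈ Submodule.span ℂ (f.vectors n) := by
  -- The inversion formula, for any enumeration `u` of the characters on an interval of length `m`.
  have key : ∀ (m a : ℕ) (u : ℕ → EuclideanSpace ℂ (Fin n)), a < m →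
      (∀ y : Fin n, ∃ b, ((b < m ∧ (y = x ↔ a = b)) ∧
        ∀ s, u s y = rootOfUnity m ^ (s * b)) ∨ (y ≠ x ∧ ∀ s, u s y = 0)) →
      EuclideanSpace.single x (1 : ℂ) =
        ∑ s ∈ Finset.range m, ((m : ℂ)⁻¹ * starRingEnd ℂ (rootOfUnity m ^ (a * s))) • u s := by
    intro m a u ha hu
    have hm : (m : ℂ) ≠ 0 := by
      norm_cast
      omega
    ext y
    simp only [WithLp.ofLp_sum, WithLp.ofLp_smul, Finset.sum_apply, Pi.smul_apply, smul_eq_mul,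
      mul_assoc, ← Finset.mul_sum]
    obtain ⟨b, ⟨⟨hb, hxy⟩, h⟩ | ⟨hxy, h⟩⟩ := hu y
    · simp only [h]
      simp only [mul_comm _ b]
      rw [sum_conj_rootOfUnity_pow_mul ha hb]
      by_cases hab : a = b
      · simp [hab, hxy.2 hab, hm]
      · have : y ≠ x := fun h => hab (hxy.1 h)
        simp [hab, this]
    · simp [h, hxy]
  cases f
  · refine Submodule.subset_span ?_
    rw [single_eq_ket]
    exact congrArg (ket n) hx
  · refine Submodule.subset_span ?_
    rw [single_eq_ket]
    exact congrArg (ket n) hx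
  · have hx' : (x : ℕ) < n - 1 := hx
    rw [key (n - 1) x (eta n) hx' ?_]
    · exact Submodule.sum_mem _ fun s hs => Submodule.smul_mem _ _
        (Submodule.subset_span ⟨s, Finset.mem_range.1 hs, rfl⟩)
    · intro y
      refine ⟨y, ?_⟩
      by_cases hy : (y : ℕ) < n - 1
      · refine Or.inl ⟨⟨hy, by rw [Fin.ext_iff, eq_comm]⟩, fun s => ?_⟩
        rw [eta_apply, if_pos hy]
      · refine Or.inr ⟨?_, fun s => ?_⟩
        · rintro rfl
          exact hy hx'
        · rw [eta_apply, if_neg hy]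
  · have hx' : 1 ≤ (x : ℕ) := hx
    rw [key (n - 1) (x - 1) (xi n) (by omega) ?_]
    · exact Submodule.sum_mem _ fun s hs => Submodule.smul_mem _ _
        (Submodule.subset_span ⟨s, Finset.mem_range.1 hs, rfl⟩)
    · intro y
      refine ⟨y - 1, ?_⟩
      by_cases hy : 1 ≤ (y : ℕ)
      · refine Or.inl ⟨⟨by omega, by rw [Fin.ext_iff]; omega⟩, fun s => ?_⟩
        rw [xi_apply, if_pos hy]
      · refine Or.inr ⟨?_, fun s => ?_⟩
        · rintro rfl
          exact hy hx'
        · rw [xi_apply, if_neg hy]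

/-! ### Product states and blocks -/

variable {ι : Type} [Fintype ι] {d : ι → ℕ}

theorem productState_apply (v : ∀ i, EuclideanSpace ℂ (Fin (d i))) (x : ∀ i, Fin (d i)) :
    productState v x = ∏ i, v i (x i) := rfl

theorem apply_eq_zero_of_notMem_cell {p : ι → Factor} {ψ : State d} (hψ : ψ ∈ block d p)
    {x : ∀ i, Fin (d i)} (hx : x ∉ cell d p) : ψ x = 0 := by
  obtain ⟨v, hv, rfl⟩ := hψ
  obtain ⟨i, hi⟩ := not_forall.1 hx
  exact Finset.prod_eq_zero (Finset.mem_univ i) (apply_eq_zero_of_notMem_coords (hv i) hi)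

theorem apply_ne_zero_of_mem_cell {p : ι → Factor} {ψ : State d}
    (hψ : ψ ∈ block d p) {x : ∀ i, Fin (d i)} (hx : x ∈ cell d p) : ψ x ≠ 0 := by
  obtain ⟨v, hv, rfl⟩ := hψ
  exact Finset.prod_ne_zero_iff.2 fun i _ => apply_ne_zero_of_mem_coords (hv i) (hx i)

theorem productState_single (x : ∀ i, Fin (d i)) :
    productState (fun i => EuclideanSpace.single (x i) (1 : ℂ)) =
      EuclideanSpace.single x (1 : ℂ) := by
  ext y
  rw [productState_apply]
  by_cases h : y = x
  · simp [h]
  · obtain ⟨i, hi⟩ := Function.ne_iff.1 h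
    rw [Finset.prod_eq_zero (Finset.mem_univ i) (by simp [hi])]
    simp [h]

variable [DecidableEq ι]

theorem inner_productState (v w : ∀ i, EuclideanSpace ℂ (Fin (d i))) :
    inner ℂ (productState v) (productState w) = ∏ i, inner ℂ (v i) (w i) := by
  simp only [inner_eq_sum, productState_apply, map_prod, ← Finset.prod_mul_distrib]
  rw [Finset.prod_univ_sum]
  simp

theorem productState_update_add (v : ∀ i, EuclideanSpace ℂ (Fin (d i))) (i : ι)
    (a b : EuclideanSpace ℂ (Fin (d i))) :
    productState (Function.update v i (a + b)) =
      productState (Function.update v i a) + productState (Function.update v i b) := by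
  ext x
  simp only [productState_apply, PiLp.add_apply]
  rw [← Finset.mul_prod_erase _ _ (Finset.mem_univ i),
    ← Finset.mul_prod_erase _ (fun j => Function.update v i a j (x j)) (Finset.mem_univ i),
    ← Finset.mul_prod_erase _ (fun j => Function.update v i b j (x j)) (Finset.mem_univ i)]
  have h : ∀ c, ∏ j ∈ Finset.univ.erase i, Function.update v i c j (x j) =
      ∏ j ∈ Finset.univ.erase i, v j (x j) := fun c =>
    Finset.prod_congr rfl fun j hj => by rw [Function.update_of_ne (Finset.ne_of_mem_erase hj)]
  simp [h, add_mul]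

theorem productState_update_smul (v : ∀ i, EuclideanSpace ℂ (Fin (d i))) (i : ι) (c : ℂ)
    (a : EuclideanSpace ℂ (Fin (d i))) :
    productState (Function.update v i (c • a)) = c • productState (Function.update v i a) := by
  ext x
  simp only [productState_apply, PiLp.smul_apply]
  rw [← Finset.mul_prod_erase _ _ (Finset.mem_univ i),
    ← Finset.mul_prod_erase _ (fun j => Function.update v i a j (x j)) (Finset.mem_univ i)]
  have h : ∀ c, ∏ j ∈ Finset.univ.erase i, Function.update v i c j (x j) =
      ∏ j ∈ Finset.univ.erase i, v j (x j) := fun c =>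
    Finset.prod_congr rfl fun j hj => by rw [Function.update_of_ne (Finset.ne_of_mem_erase hj)]
  simp [h, mul_assoc]

/-- A tensor product of linear combinations is a linear combination of tensor products; the
factors in `s` are expanded one at a time. -/
theorem productState_mem_span {V : ∀ i, Set (EuclideanSpace ℂ (Fin (d i)))} (s : Finset ι) :
    ∀ u : ∀ i, EuclideanSpace ℂ (Fin (d i)), (∀ i ∈ s, u i ∈ Submodule.span ℂ (V i)) →
      (∀ i ∉ s, u i ∈ V i) →
      productState u ∈ Submodule.span ℂ {ψ | ∃ v, (∀ i, v i ∈ V i) ∧ ψ = productState v} := by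
  induction s using Finset.induction_on with
  | empty => exact fun u _ hu => Submodule.subset_span ⟨u, fun i => hu i (by simp), rfl⟩
  | insert i s his ih =>
    intro u hs hns
    have key : ∀ a ∈ Submodule.span ℂ (V i), productState (Function.update u i a) ∈
        Submodule.span ℂ {ψ | ∃ v, (∀ i, v i ∈ V i) ∧ ψ = productState v} := by
      intro a ha
      induction ha using Submodule.span_induction with
      | mem a ha =>
        refine ih _ (fun j hj => ?_) (fun j hj => ?_)
        · rw [Function.update_of_ne (ne_of_mem_of_not_mem hj his)]
          exact hs j (Finset.mem_insert_of_mem hj)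
        · rcases eq_or_ne j i with rfl | hji
          · simpa using ha
          · rw [Function.update_of_ne hji]
            exact hns j (by simp [hji, hj])
      | zero =>
        have := productState_update_smul u i 0 0
        rw [zero_smul, zero_smul] at this
        rw [this]
        exact Submodule.zero_mem _
      | add a b _ _ ha hb =>
        rw [productState_update_add]
        exact Submodule.add_mem _ ha hb
      | smul c a _ ha =>
        rw [productState_update_smul]
        exact Submodule.smul_mem _ _ ha
    have := key (u i) (hs i (Finset.mem_insert_self i s))
    rwa [Function.update_eq_self] at this

theorem block_pairwise_orthogonal (p : ι → Factor) :
    (block d p).Pairwise fun ψ φ => inner ℂ ψ φ = 0 := by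
  rintro _ ⟨v, hv, rfl⟩ _ ⟨w, hw, rfl⟩ hne
  obtain ⟨i, hi⟩ := Function.ne_iff.1 fun h : v = w => hne (congrArg productState h)
  rw [inner_productState]
  exact Finset.prod_eq_zero (Finset.mem_univ i)
    (vectors_pairwise_orthogonal _ _ (hv i) (hw i) hi)

theorem inner_eq_zero_of_disjoint_cells {p q : ι → Factor} (h : Disjoint (cell d p) (cell d q))
    {ψ φ : State d} (hψ : ψ ∈ block d p) (hφ : φ ∈ block d q) : inner ℂ ψ φ = 0 := by
  rw [inner_eq_sum]
  refine Finset.sum_eq_zero fun x _ => ?_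
  by_cases hx : x ∈ cell d p
  · rw [apply_eq_zero_of_notMem_cell hφ (Set.disjoint_left.1 h hx), mul_zero]
  · rw [apply_eq_zero_of_notMem_cell hψ hx, map_zero, zero_mul]

theorem eq_sum_single (ψ : State d) :
    ψ = ∑ x, ψ x • EuclideanSpace.single x (1 : ℂ) := by
  ext y
  simp [Pi.single_apply]

theorem span_block (p : ι → Factor) :
    Submodule.span ℂ (block d p) = basisSpan d (cell d p) := by
  apply le_antisymm
  · refine Submodule.span_le.2 fun ψ hψ => ?_
    rw [eq_sum_single ψ]
    refine Submodule.sum_mem _ fun x _ => ?_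
    by_cases hx : x ∈ cell d p
    · exact Submodule.smul_mem _ _ (Submodule.subset_span ⟨x, hx, rfl⟩)
    · rw [apply_eq_zero_of_notMem_cell hψ hx, zero_smul]
      exact Submodule.zero_mem _
  · refine Submodule.span_le.2 ?_
    rintro _ ⟨x, hx, rfl⟩
    change EuclideanSpace.single x (1 : ℂ) ∈ _
    rw [← productState_single]
    exact productState_mem_span (V := fun i => (p i).vectors (d i)) Finset.univ _
      (fun i _ => single_mem_span_vectors (hx i)) (fun i hi => absurd (Finset.mem_univ i) hi)

theorem single_mem_span_block {p : ι → Factor} {x : ∀ i, Fin (d i)} (hx : x ∈ cell d p) :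
    EuclideanSpace.single x (1 : ℂ) ∈ Submodule.span ℂ (block d p) := by
  rw [span_block]
  exact Submodule.subset_span ⟨x, hx, rfl⟩

/-! ### Matrices that preserve the orthogonality of the blocks -/

theorem toEuclideanLin_apply_eq_sum {α : Type} [Fintype α] [DecidableEq α] (F : Matrix α α ℂ)
    (φ : EuclideanSpace ℂ α) (x : α) : Matrix.toEuclideanLin F φ x = ∑ y, F x y * φ y := by
  simp [Matrix.toEuclideanLin, Matrix.toLpLin_apply, Matrix.mulVec, dotProduct]

theorem inner_single_eq {α : Type} [Fintype α] [DecidableEq α] (x : α)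
    (φ : EuclideanSpace ℂ α) : inner ℂ (EuclideanSpace.single x (1 : ℂ)) φ = φ x := by
  simp [EuclideanSpace.inner_single_left]

theorem toEuclideanLin_single_apply {α : Type} [Fintype α] [DecidableEq α] (F : Matrix α α ℂ)
    (x y : α) : Matrix.toEuclideanLin F (EuclideanSpace.single y (1 : ℂ)) x = F x y := by
  simp [toEuclideanLin_apply_eq_sum]

theorem toEuclideanLin_sub_smul_one {α : Type} [Fintype α] [DecidableEq α] (F : Matrix α α ℂ)
    (c : ℂ) (φ : EuclideanSpace ℂ α) :
    Matrix.toEuclideanLin (F - c • 1) φ = Matrix.toEuclideanLin F φ - c • φ := by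
  rw [map_sub, map_smul, Matrix.toEuclideanLin, Matrix.toLpLin_one]
  rfl

theorem inner_map_eq_zero_of_mem_span {E : Type} [NormedAddCommGroup E] [InnerProductSpace ℂ E]
    (L : E →ₗ[ℂ] E) {S S' : Set E} (h : ∀ ψ ∈ S, ∀ φ ∈ S', inner ℂ ψ (L φ) = 0) {ψ φ : E}
    (hψ : ψ ∈ Submodule.span ℂ S) (hφ : φ ∈ Submodule.span ℂ S') : inner ℂ ψ (L φ) = 0 := by
  induction hψ using Submodule.span_induction with
  | mem ψ hψ =>
    induction hφ using Submodule.span_induction with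
    | mem φ hφ => exact h ψ hψ φ hφ
    | zero => simp
    | add a b _ _ ha hb => rw [map_add, inner_add_right, ha, hb, add_zero]
    | smul c a _ ha => rw [map_smul, inner_smul_right, ha, mul_zero]
  | zero => simp
  | add a b _ _ ha hb => rw [inner_add_left, ha, hb, add_zero]
  | smul c a _ ha => rw [inner_smul_left, ha, mul_zero]

theorem entry_eq_zero_of_blocks {F : Matrix (∀ i, Fin (d i)) (∀ i, Fin (d i)) ℂ}
    {p q : ι → Factor}
    (hF : ∀ ψ ∈ block d p, ∀ φ ∈ block d q, inner ℂ ψ (Matrix.toEuclideanLin F φ) = 0)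
    {x y : ∀ i, Fin (d i)} (hx : x ∈ cell d p) (hy : y ∈ cell d q) : F x y = 0 := by
  have := inner_map_eq_zero_of_mem_span _ hF (single_mem_span_block hx) (single_mem_span_block hy)
  rwa [inner_single_eq, toEuclideanLin_single_apply] at this

/-- A matrix that preserves the orthogonality of a block acts on the cell as a diagonal matrix in
the Fourier basis. If, moreover, the row of a single point `x₀` of the cell vanishes off the
diagonal, then all the eigenvalues agree, since no Fourier vector vanishes at `x₀`: the matrix is
scalar on the cell. -/
theorem entry_eq_of_isolated_point
    {F : Matrix (∀ i, Fin (d i)) (∀ i, Fin (d i)) ℂ} {p : ι → Factor}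
    (hF : (block d p).Pairwise fun ψ φ => inner ℂ ψ (Matrix.toEuclideanLin F φ) = 0)
    {x₀ : ∀ i, Fin (d i)} (hx₀ : x₀ ∈ cell d p) (h₀ : ∀ y ∈ cell d p, y ≠ x₀ → F x₀ y = 0)
    {x y : ∀ i, Fin (d i)} (hx : x ∈ cell d p) (hy : y ∈ cell d p) :
    F x y = if x = y then F x₀ x₀ else 0 := by
  set c := F x₀ x₀ with hc
  have hrow : ∀ φ ∈ block d p, Matrix.toEuclideanLin F φ x₀ = c * φ x₀ := by
    intro φ hφ
    rw [toEuclideanLin_apply_eq_sum, Finset.sum_eq_single x₀]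
    · intro z _ hz
      by_cases hzc : z ∈ cell d p
      · rw [h₀ z hzc hz, zero_mul]
      · rw [apply_eq_zero_of_notMem_cell hφ hzc, mul_zero]
    · exact fun h => absurd (Finset.mem_univ _) h
  have hscal : ∀ ψ ∈ block d p, ∀ φ ∈ block d p,
      inner ℂ ψ (Matrix.toEuclideanLin (F - c • 1) φ) = 0 := by
    intro ψ hψ φ hφ
    have hφ0 : φ x₀ ≠ 0 := apply_ne_zero_of_mem_cell hφ hx₀
    have hφφ : inner ℂ φ φ ≠ 0 := by
      rw [inner_self_ne_zero]
      rintro rfl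
      exact hφ0 rfl
    -- `φ` is an eigenvector of the compression of `F` to the cell, with eigenvalue `l`.
    set l := inner ℂ φ (Matrix.toEuclideanLin F φ) / inner ℂ φ φ with hl
    have heig : ∀ χ ∈ block d p, ∀ φ' ∈ ({φ} : Set (State d)),
        inner ℂ χ (Matrix.toEuclideanLin (F - l • 1) φ') = 0 := by
      intro χ hχ φ' hφ'
      rw [Set.mem_singleton_iff.1 hφ', toEuclideanLin_sub_smul_one, inner_sub_right, inner_smul_right]
      by_cases hχφ : χ = φ
      · rw [hχφ, hl, div_mul_cancel₀ _ hφφ, sub_self]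
      · rw [hF hχ hφ hχφ, block_pairwise_orthogonal p hχ hφ hχφ, mul_zero, sub_self]
    have hlc : l = c := by
      have := inner_map_eq_zero_of_mem_span _ heig (single_mem_span_block hx₀)
        (Submodule.subset_span (Set.mem_singleton φ))
      rw [inner_single_eq, toEuclideanLin_sub_smul_one, PiLp.sub_apply, PiLp.smul_apply,
        hrow φ hφ, smul_eq_mul, ← sub_mul] at this
      exact (sub_eq_zero.1 ((mul_eq_zero.1 this).resolve_right hφ0)).symm
    rw [← hlc]
    exact heig ψ hψ φ rfl
  have := entry_eq_zero_of_blocks hscal hx hy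
  rw [Matrix.sub_apply, Matrix.smul_apply, Matrix.one_apply, sub_eq_zero] at this
  rw [this]
  simp

/-! ### Zones: the combinatorics of the blocks -/

/-- The position of a coordinate: `0` and `2` for the two ends of `{0, …, n-1}`, and `1` for the
interior. Whether a coordinate belongs to a factor depends on its zone only. -/
def zone {n : ℕ} (x : Fin n) : Fin 3 :=
  if (x : ℕ) = 0 then 0 else if (x : ℕ) = n - 1 then 2 else 1

/-- The zones of the coordinates of a factor. -/
def Factor.zones : Factor → Finset (Fin 3)
  | .first => {0}
  | .last => {2}
  | .eta => {0, 1}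
  | .xi => {1, 2}

theorem mem_coords_iff {n : ℕ} (hn : 3 ≤ n) (f : Factor) (x : Fin n) :
    x ∈ f.coords n ↔ zone x ∈ f.zones := by
  have hx := x.isLt
  cases f <;> simp only [Factor.coords, Set.mem_ofPred_eq, zone, Factor.zones] <;>
    split_ifs <;> simp <;> omega

theorem zone_surjective {n : ℕ} (hn : 3 ≤ n) : Function.Surjective (zone (n := n)) := by
  intro t
  have h : ∃ k, k < n ∧ (if k = 0 then (0 : Fin 3) else if k = n - 1 then 2 else 1) = t := by
    fin_cases t
    · exact ⟨0, by omega, by simp⟩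
    · exact ⟨1, by omega, by rw [if_neg (by omega), if_neg (by omega)]; rfl⟩
    · exact ⟨n - 1, by omega, by rw [if_neg (by omega), if_pos rfl]; rfl⟩
  obtain ⟨k, hk, h⟩ := h
  exact ⟨⟨k, hk⟩, h⟩

theorem eq_of_zone_eq {n : ℕ} {x y : Fin n} (h : zone x = zone y) (h1 : zone x ≠ 1) : x = y := by
  rw [Fin.ext_iff]
  unfold zone at h h1
  split_ifs at h h1 <;> omega

theorem zone_ne_one_iff {n : ℕ} (x : Fin n) : zone x ≠ 1 ↔ (x : ℕ) = 0 ∨ (x : ℕ) = n - 1 := by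
  unfold zone
  split_ifs <;> simp_all

theorem exists_disjoint_zones {a b : Fin 8 ⊕ Fin 8} (h : a ≠ b) :
    ∃ i, Disjoint (pattern a i).zones (pattern b i).zones := by
  revert a b
  decide +kernel

theorem exists_pattern_of_zones {t : Fin 4 → Fin 3} (h : ∃ i, t i ≠ 1) :
    ∃ b, ∀ i, t i ∈ (pattern b i).zones := by
  revert t
  decide +kernel

theorem exists_one_notMem_zones (b : Fin 8 ⊕ Fin 8) : ∃ i, 1 ∉ (pattern b i).zones := by
  revert b
  decide +kernel

theorem exists_end_mem_zones (f : Factor) : ∃ t ∈ f.zones, t ≠ 1 := by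
  cases f <;> decide

/-- The projections of the cells of two blocks along the party `X` overlap. -/
def Overlap (X : Fin 4) (a b : Fin 8 ⊕ Fin 8) : Prop :=
  ∀ i, i ≠ X → ∃ t, t ∈ (pattern a i).zones ∧ t ∈ (pattern b i).zones

instance (X : Fin 4) (a b : Fin 8 ⊕ Fin 8) : Decidable (Overlap X a b) :=
  inferInstanceAs (Decidable (∀ i, i ≠ X → ∃ t, t ∈ (pattern a i).zones ∧ t ∈ (pattern b i).zones))

/-- The blocks that overlap some block in `B` along `X`. -/
def neighbors (X : Fin 4) (B : Finset (Fin 8 ⊕ Fin 8)) : Finset (Fin 8 ⊕ Fin 8) :=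
  Finset.univ.filter fun b => ∃ a ∈ B, Overlap X a b

/-- For each party `X` there are a block `a` that meets the face `x_X = 0` and a block `b` that
meets the opposite face whose projections along `X` have exactly one point in common, a corner;
moreover, every block is connected to `a` by a chain of at most four overlaps. -/
theorem exists_corner_and_connected (X : Fin 4) :
    ∃ a b, 0 ∈ (pattern a X).zones ∧ 2 ∈ (pattern b X).zones ∧
      (∃ t : Fin 4 → Fin 3, ∀ i, i ≠ X → t i ≠ 1 ∧
        ∀ s, s ∈ (pattern a i).zones ∧ s ∈ (pattern b i).zones ↔ s = t i) ∧
      ∀ c, c ∈ neighbors X (neighbors X (neighbors X (neighbors X {a}))) := by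
  fin_cases X
  · refine ⟨.inr 3, .inl 4, ?_⟩
    decide +kernel
  · refine ⟨.inl 5, .inl 1, ?_⟩
    decide +kernel
  · refine ⟨.inl 0, .inl 6, ?_⟩
    decide +kernel
  · refine ⟨.inl 7, .inl 2, ?_⟩
    decide +kernel

/-! ### The decomposition of the outermost layer -/

section Layer

variable {d : Fin 4 → ℕ}

theorem mem_cell_iff (hd : ∀ i, 3 ≤ d i) {b : Fin 8 ⊕ Fin 8} {x : ∀ i, Fin (d i)} :
    x ∈ cell d (pattern b) ↔ ∀ i, zone (x i) ∈ (pattern b i).zones :=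
  forall_congr' fun i => mem_coords_iff (hd i) _ _

theorem disjoint_cells (hd : ∀ i, 3 ≤ d i) {a b : Fin 8 ⊕ Fin 8} (h : a ≠ b) :
    Disjoint (cell d (pattern a)) (cell d (pattern b)) := by
  obtain ⟨i, hi⟩ := exists_disjoint_zones h
  refine Set.disjoint_left.2 fun x hx hx' => ?_
  exact Finset.disjoint_left.1 hi ((mem_cell_iff hd).1 hx i) ((mem_cell_iff hd).1 hx' i)

theorem exists_mem_cell (hd : ∀ i, 3 ≤ d i) {x : ∀ i, Fin (d i)} (h : ∃ i, zone (x i) ≠ 1) :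
    ∃ b, x ∈ cell d (pattern b) := by
  obtain ⟨b, hb⟩ := exists_pattern_of_zones (t := fun i => zone (x i)) h
  exact ⟨b, (mem_cell_iff hd).2 hb⟩

theorem iUnion_cell (hd : ∀ i, 3 ≤ d i) :
    ⋃ b, cell d (pattern b) = outermostLayer d := by
  ext x
  rw [Set.mem_iUnion]
  constructor
  · rintro ⟨b, hb⟩
    obtain ⟨i, hi⟩ := exists_one_notMem_zones b
    refine ⟨i, (zone_ne_one_iff _).1 fun h => hi ?_⟩
    rw [← h]
    exact (mem_cell_iff hd).1 hb i
  · rintro ⟨i, hi⟩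
    exact exists_mem_cell hd ⟨i, (zone_ne_one_iff _).2 hi⟩

theorem exists_point_of_zones (hd : ∀ i, 3 ≤ d i) (t : Fin 4 → Fin 3) :
    ∃ x : ∀ i, Fin (d i), ∀ i, zone (x i) = t i := by
  choose x hx using fun i => zone_surjective (hd i) (t i)
  exact ⟨x, hx⟩

theorem exists_mem_cell_pattern (hd : ∀ i, 3 ≤ d i) (b : Fin 8 ⊕ Fin 8) :
    ∃ x, x ∈ cell d (pattern b) := by
  choose t ht _ using fun i => exists_end_mem_zones (pattern b i)
  obtain ⟨x, hx⟩ := exists_point_of_zones hd t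
  refine ⟨x, (mem_cell_iff hd).2 fun i => ?_⟩
  rw [hx]
  exact ht i

theorem ne_zero_of_mem_block (hd : ∀ i, 3 ≤ d i) {b : Fin 8 ⊕ Fin 8} {ψ : State d}
    (hψ : ψ ∈ block d (pattern b)) : ψ ≠ 0 := by
  obtain ⟨x, hx⟩ := exists_mem_cell_pattern hd b
  rintro rfl
  exact apply_ne_zero_of_mem_cell hψ hx rfl

theorem mem_fourPartySet {ψ : State d} : ψ ∈ fourPartySet d ↔ ∃ b, ψ ∈ block d (pattern b) :=
  Set.mem_iUnion

theorem fourPartySet_isOrthogonalProductSet (hd : ∀ i, 3 ≤ d i) :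
    IsOrthogonalProductSet (fourPartySet d) := by
  constructor
  · intro ψ hψ
    obtain ⟨b, hb⟩ := mem_fourPartySet.1 hψ
    refine ⟨ne_zero_of_mem_block hd hb, ?_⟩
    obtain ⟨v, -, rfl⟩ := hb
    exact ⟨v, rfl⟩
  · intro ψ hψ φ hφ hne
    obtain ⟨a, ha⟩ := mem_fourPartySet.1 hψ
    obtain ⟨b, hb⟩ := mem_fourPartySet.1 hφ
    rcases eq_or_ne a b with rfl | hab
    · exact block_pairwise_orthogonal _ ha hb hne
    · exact inner_eq_zero_of_disjoint_cells (disjoint_cells hd hab) ha hb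

theorem span_fourPartySet (hd : ∀ i, 3 ≤ d i) :
    Submodule.span ℂ (fourPartySet d) = basisSpan d (outermostLayer d) := by
  rw [fourPartySet, Submodule.span_iUnion, ← iUnion_cell hd, basisSpan, Set.image_iUnion,
    Submodule.span_iUnion]
  exact iSup_congr fun b => span_block _

theorem ncard_fourPartySet_eq_ncard (hd : ∀ i, 3 ≤ d i) :
    (fourPartySet d).ncard = (outermostLayer d).ncard := by
  have hS := fourPartySet_isOrthogonalProductSet hd
  have hli : LinearIndependent ℂ (fun ψ : fourPartySet d => (ψ : State d)) :=
    linearIndependent_of_ne_zero_of_inner_eq_zero (fun ψ => (hS.1 ψ ψ.2).1)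
      fun ψ φ hne => hS.2 ψ.2 φ.2 fun h => hne (Subtype.ext h)
  have hli' : LinearIndependent ℂ
      (fun x : (fun x => EuclideanSpace.single x (1 : ℂ)) '' outermostLayer d => (x : State d)) :=
    (EuclideanSpace.orthonormal_single (𝕜 := ℂ)).linearIndependent.linearIndepOn_id.mono
      (Set.image_subset_range _ _)
  have h1 := rank_span_set hli
  have h2 := rank_span_set hli'
  have hspan := span_fourPartySet hd
  rw [basisSpan] at hspan
  rw [hspan, h2] at h1
  rw [← Set.ncard_image_of_injective (outermostLayer d)
    (EuclideanSpace.orthonormal_single (𝕜 := ℂ)).linearIndependent.injective]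
  exact (congrArg Cardinal.toNat h1).symm

theorem card_interior {n : ℕ} (hn : 3 ≤ n) :
    (Finset.univ.filter fun x : Fin n => ¬((x : ℕ) = 0 ∨ (x : ℕ) = n - 1)).card = n - 2 := by
  have h : (Finset.univ.filter fun x : Fin n => ¬((x : ℕ) = 0 ∨ (x : ℕ) = n - 1)) =
      Finset.univ \ {⟨0, by omega⟩, ⟨n - 1, by omega⟩} := by
    ext x
    simp [Fin.ext_iff]
  rw [h, Finset.card_sdiff_of_subset (Finset.subset_univ _), Finset.card_univ, Fintype.card_fin,
    Finset.card_pair]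
  simp only [ne_eq, Fin.mk.injEq]
  omega

theorem ncard_outermostLayer (hd : ∀ i, 3 ≤ d i) :
    ((outermostLayer d).ncard : ℤ) =
      (d 0 : ℤ) * d 1 * d 2 * d 3 -
        ((d 0 : ℤ) - 2) * ((d 1 : ℤ) - 2) * ((d 2 : ℤ) - 2) * ((d 3 : ℤ) - 2) := by
  have hcompl : (outermostLayer d)ᶜ = ↑(Fintype.piFinset fun i =>
      Finset.univ.filter fun x : Fin (d i) => ¬((x : ℕ) = 0 ∨ (x : ℕ) = d i - 1)) := by
    ext x
    simp [outermostLayer]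
  have h := Set.ncard_add_ncard_compl (outermostLayer d)
  rw [hcompl, Set.ncard_coe_finset, Fintype.card_piFinset, Nat.card_pi] at h
  simp only [Nat.card_fin] at h
  rw [Finset.prod_congr rfl fun i _ => card_interior (hd i), Fin.prod_univ_four,
    Fin.prod_univ_four] at h
  have h' := congrArg (Nat.cast : ℕ → ℤ) h
  have h2 : ∀ i, ((d i - 2 : ℕ) : ℤ) = (d i : ℤ) - 2 := fun i => by
    have := hd i
    omega
  push_cast [h2] at h'
  linarith

end Layer

/-! ### Triviality of orthogonality-preserving operators -/

section Core

/-- The row of `F` at `x` is that of the matrix `c • 1`. -/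
def IsScalarRow {α : Type} (F : Matrix α α ℂ) (c : ℂ) (x : α) : Prop :=
  F x x = c ∧ ∀ y, y ≠ x → F x y = 0

/-- `F` acts as the identity on the party `X`. -/
structure ActsTriviallyOn {d : Fin 4 → ℕ} (F : Matrix (∀ i, Fin (d i)) (∀ i, Fin (d i)) ℂ)
    (X : Fin 4) : Prop where
  entry_eq_zero : ∀ x y, x X ≠ y X → F x y = 0
  entry_update : ∀ x y z, x X = y X →
    F (Function.update x X z) (Function.update y X z) = F x y

variable {d : Fin 4 → ℕ} {F : Matrix (∀ i, Fin (d i)) (∀ i, Fin (d i)) ℂ} {X : Fin 4} {c : ℂ}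

theorem IsScalarRow.update (hX : ActsTriviallyOn F X) {x : ∀ i, Fin (d i)}
    (hx : IsScalarRow F c x) (z : Fin (d X)) : IsScalarRow F c (Function.update x X z) := by
  refine ⟨by rw [hX.entry_update x x z rfl, hx.1], fun y hy => ?_⟩
  by_cases hyz : y X = z
  · subst hyz
    have h := hX.entry_update (Function.update x X (y X)) y (x X) (by simp)
    rw [Function.update_idem, Function.update_eq_self] at h
    rw [← h]
    refine hx.2 _ fun h' => hy ?_
    rw [← h', Function.update_idem, Function.update_eq_self]
  · exact hX.entry_eq_zero _ _ (by simpa using Ne.symm hyz)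

variable (hd : ∀ i, 3 ≤ d i)
  (hF : (fourPartySet d).Pairwise fun ψ φ => inner ℂ ψ (Matrix.toEuclideanLin F φ) = 0)

include hd hF

theorem entry_eq_zero_of_cells_ne {a b : Fin 8 ⊕ Fin 8} (hab : a ≠ b) {x y : ∀ i, Fin (d i)}
    (hx : x ∈ cell d (pattern a)) (hy : y ∈ cell d (pattern b)) : F x y = 0 := by
  refine entry_eq_zero_of_blocks (fun ψ hψ φ hφ => ?_) hx hy
  refine hF (mem_fourPartySet.2 ⟨a, hψ⟩) (mem_fourPartySet.2 ⟨b, hφ⟩) ?_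
  rintro rfl
  have := inner_eq_zero_of_disjoint_cells (disjoint_cells hd hab) hψ hφ
  exact ne_zero_of_mem_block hd hψ (inner_self_eq_zero.1 this)

/-- A point of the layer has no off-diagonal entries outside of its own cell. -/
theorem mem_cell_of_entry_ne_zero {b : Fin 8 ⊕ Fin 8} {x y : ∀ i, Fin (d i)}
    (hx : x ∈ cell d (pattern b)) (hy : ∃ i, zone (y i) ≠ 1) (h : F x y ≠ 0) :
    y ∈ cell d (pattern b) := by
  obtain ⟨a, ha⟩ := exists_mem_cell hd hy
  rcases eq_or_ne b a with rfl | hab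
  · exact ha
  · exact absurd (entry_eq_zero_of_cells_ne hd hF hab hx ha) h

theorem IsScalarRow.of_mem_cell (hX : ActsTriviallyOn F X) {b : Fin 8 ⊕ Fin 8}
    {x x' : ∀ i, Fin (d i)} (hx : x ∈ cell d (pattern b)) (hx' : x' ∈ cell d (pattern b))
    (h : IsScalarRow F c x) : IsScalarRow F c x' := by
  obtain ⟨t, ht, ht1⟩ := exists_end_mem_zones (pattern b X)
  obtain ⟨z, rfl⟩ := zone_surjective (hd X) t
  -- Move `x'` to an end of the edge in direction `X`, where the cells cover all the points.
  have hw : Function.update x' X z ∈ cell d (pattern b) := by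
    refine (mem_cell_iff hd).2 fun i => ?_
    rcases eq_or_ne i X with rfl | hi
    · simpa using ht
    · rw [Function.update_of_ne hi]
      exact (mem_cell_iff hd).1 hx' i
  have hcell : ∀ {y}, y ∈ cell d (pattern b) →
      F (Function.update x' X z) y = if Function.update x' X z = y then F x x else 0 := fun hy =>
    entry_eq_of_isolated_point
      (fun ψ hψ φ hφ hne => hF (mem_fourPartySet.2 ⟨b, hψ⟩) (mem_fourPartySet.2 ⟨b, hφ⟩) hne)
      hx (fun y _ hy => h.2 y hy) hw hy
  have hrow : IsScalarRow F c (Function.update x' X z) := by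
    refine ⟨by rw [hcell hw, if_pos rfl, h.1], fun y hy => ?_⟩
    by_contra hne
    have hyX : y X = z := by
      by_contra hyX
      exact hne (hX.entry_eq_zero _ _ (by simpa using Ne.symm hyX))
    have hyb := mem_cell_of_entry_ne_zero hd hF hw ⟨X, by rwa [hyX]⟩ hne
    rw [hcell hyb, if_neg (Ne.symm hy)] at hne
    exact hne rfl
  have := hrow.update hX (x' X)
  rwa [Function.update_idem, Function.update_eq_self] at this

theorem IsScalarRow.of_overlap (hX : ActsTriviallyOn F X) {a b : Fin 8 ⊕ Fin 8}
    (hab : Overlap X a b) (ha : ∀ x ∈ cell d (pattern a), IsScalarRow F c x) :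
    ∀ x ∈ cell d (pattern b), IsScalarRow F c x := by
  obtain ⟨ta, hta, -⟩ := exists_end_mem_zones (pattern a X)
  obtain ⟨tb, htb, -⟩ := exists_end_mem_zones (pattern b X)
  obtain ⟨z, rfl⟩ := zone_surjective (hd X) tb
  choose! t ht using hab
  obtain ⟨w, hw⟩ := exists_point_of_zones hd (Function.update t X ta)
  have hwa : w ∈ cell d (pattern a) := by
    refine (mem_cell_iff hd).2 fun i => ?_
    rw [hw]
    rcases eq_or_ne i X with rfl | hi
    · simpa using hta
    · rw [Function.update_of_ne hi]
      exact (ht i hi).1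
  have hwb : Function.update w X z ∈ cell d (pattern b) := by
    refine (mem_cell_iff hd).2 fun i => ?_
    rcases eq_or_ne i X with rfl | hi
    · simpa using htb
    · rw [Function.update_of_ne hi, hw, Function.update_of_ne hi]
      exact (ht i hi).2
  exact fun x hx => IsScalarRow.of_mem_cell hd hF hX hwb hx ((ha w hwa).update hX z)

theorem IsScalarRow.of_mem_neighbors (hX : ActsTriviallyOn F X) {B : Finset (Fin 8 ⊕ Fin 8)}
    (hB : ∀ b ∈ B, ∀ x ∈ cell d (pattern b), IsScalarRow F c x) :
    ∀ b ∈ neighbors X B, ∀ x ∈ cell d (pattern b), IsScalarRow F c x := by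
  intro b hb
  obtain ⟨a, ha, hab⟩ := (Finset.mem_filter.1 hb).2
  exact IsScalarRow.of_overlap hd hF hX hab (hB a ha)

theorem exists_eq_smul_one (hX : ActsTriviallyOn F X) : ∃ c : ℂ, F = c • 1 := by
  obtain ⟨a, b, ha0, hb2, ⟨t, ht⟩, hconn⟩ := exists_corner_and_connected X
  obtain ⟨x, hx⟩ := exists_point_of_zones hd (Function.update t X 0)
  have hxX : zone (x X) = 0 := by rw [hx, Function.update_self]
  have hxt : ∀ i, i ≠ X → zone (x i) = t i := fun i hi => by rw [hx, Function.update_of_ne hi]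
  obtain ⟨z, hz⟩ := zone_surjective (hd X) 2
  have hxa : x ∈ cell d (pattern a) := by
    refine (mem_cell_iff hd).2 fun i => ?_
    rcases eq_or_ne i X with rfl | hi
    · rwa [hxX]
    · exact (((ht i hi).2 _).2 (hxt i hi)).1
  have hxb : Function.update x X z ∈ cell d (pattern b) := by
    refine (mem_cell_iff hd).2 fun i => ?_
    rcases eq_or_ne i X with rfl | hi
    · rwa [Function.update_self, hz]
    · rw [Function.update_of_ne hi]
      exact (((ht i hi).2 _).2 (hxt i hi)).2
  -- The corner `x` is isolated: a point `y` with `F x y ≠ 0` lies on the same face as `x`, in the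
  -- same cell, and its shift to the opposite face lies in the same cell as the shift of `x`.
  have hrow : IsScalarRow F (F x x) x := by
    refine ⟨rfl, fun y hy => ?_⟩
    by_contra hne
    have hyX : x X = y X := by
      by_contra hyX
      exact hne (hX.entry_eq_zero _ _ hyX)
    have hya := mem_cell_of_entry_ne_zero hd hF hxa ⟨X, by rw [← hyX, hxX]; decide⟩ hne
    rw [← hX.entry_update x y z hyX] at hne
    have hyb := mem_cell_of_entry_ne_zero hd hF hxb
      ⟨X, by rw [Function.update_self, hz]; decide⟩ hne
    refine hy (funext fun i => ?_)
    rcases eq_or_ne i X with rfl | hi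
    · exact hyX.symm
    · have hyi := (mem_cell_iff hd).1 hyb i
      rw [Function.update_of_ne hi] at hyi
      have hyt := ((ht i hi).2 _).1 ⟨(mem_cell_iff hd).1 hya i, hyi⟩
      exact eq_of_zone_eq (hyt.trans (hxt i hi).symm) (by rw [hyt]; exact (ht i hi).1)
  have hall : ∀ b, ∀ y ∈ cell d (pattern b), IsScalarRow F (F x x) y := by
    have step := fun B => IsScalarRow.of_mem_neighbors (c := F x x) (B := B) hd hF hX
    have h0 : ∀ b ∈ ({a} : Finset (Fin 8 ⊕ Fin 8)), ∀ y ∈ cell d (pattern b),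
        IsScalarRow F (F x x) y := by
      intro b hb y hy
      rw [Finset.mem_singleton.1 hb] at hy
      exact IsScalarRow.of_mem_cell hd hF hX hxa hy hrow
    exact fun b => step _ (step _ (step _ (step _ h0))) b (hconn b)
  refine ⟨F x x, ?_⟩
  ext y y'
  obtain ⟨b, hb⟩ := exists_mem_cell hd (x := Function.update y X z)
    ⟨X, by rw [Function.update_self, hz]; decide⟩
  have hy := (hall b _ hb).update hX (y X)
  rw [Function.update_idem, Function.update_eq_self] at hy
  rw [Matrix.smul_apply, Matrix.one_apply]
  split_ifs with h
  · rw [← h, hy.1, smul_eq_mul, mul_one]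
  · rw [hy.2 y' (Ne.symm h), smul_zero]

end Core

/-! ### Local operators -/

section LocalOperators

variable {ι : Type} [Fintype ι] [DecidableEq ι] {d : ι → ℕ} {T : Finset ι}

theorem extend_eq_submatrix (M : LocalMatrix d T) :
    extend M = (Matrix.kroneckerMap (· * ·) M
      (1 : Matrix (∀ i : {i // i ∉ T}, Fin (d i)) _ ℂ)).submatrix
      (Equiv.piEquivPiSubtypeProd (· ∈ T) fun i => Fin (d i))
      (Equiv.piEquivPiSubtypeProd (· ∈ T) fun i => Fin (d i)) := by
  ext x y
  simp only [extend, Matrix.of_apply, Matrix.submatrix_apply, Matrix.kroneckerMap_apply,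
    Equiv.piEquivPiSubtypeProd_apply, Matrix.one_apply, funext_iff, Subtype.forall]

theorem extend_mul (M N : LocalMatrix d T) : extend (M * N) = extend M * extend N := by
  simp only [extend_eq_submatrix, Matrix.submatrix_mul_equiv]
  rw [← Matrix.mul_kronecker_mul, one_mul]

theorem extend_conjTranspose (M : LocalMatrix d T) :
    extend M.conjTranspose = (extend M).conjTranspose := by
  simp only [extend_eq_submatrix, Matrix.conjTranspose_submatrix]
  rw [Matrix.conjTranspose_kronecker, Matrix.conjTranspose_one]

theorem extend_smul_one (c : ℂ) : extend (c • (1 : LocalMatrix d T)) = c • 1 := by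
  rw [extend_eq_submatrix, Matrix.smul_kronecker, Matrix.one_kronecker_one,
    Matrix.submatrix_smul, Pi.smul_apply, Pi.smul_apply, Matrix.submatrix_one_equiv]

theorem extend_injective (hd : ∀ i, 0 < d i) :
    Function.Injective (extend : LocalMatrix d T → _) := by
  intro M N h
  ext a b
  let f : (∀ i : T, Fin (d i)) → ∀ i, Fin (d i) := fun a i =>
    if hi : i ∈ T then a ⟨i, hi⟩ else ⟨0, hd i⟩
  have hf : ∀ a, (fun i : T => f a i) = a := fun a => funext fun i => dif_pos i.2
  have hfab : ∀ i, i ∉ T → f a i = f b i := fun i hi => by simp only [f, dif_neg hi]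
  have := congrFun (congrFun h (f a)) (f b)
  simpa only [extend, Matrix.of_apply, hf, if_pos hfab, mul_one] using this

theorem extend_mul_extend_apply {P Q : Finset ι} (hPQ : ∀ i, i ∈ P ↔ i ∉ Q) (A : LocalMatrix d P)
    (B : LocalMatrix d Q) (x y : ∀ i, Fin (d i)) :
    (extend A * extend B) x y = A (fun i => x i) (fun i => y i) * B (fun i => x i) fun i => y i := by
  rw [Matrix.mul_apply, Finset.sum_eq_single fun i => if i ∈ P then y i else x i]
  · have hP : (fun i : P => if (i : ι) ∈ P then y i else x i) = fun i : P => y i :=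
      funext fun i => if_pos i.2
    have hQ : (fun i : Q => if (i : ι) ∈ P then y i else x i) = fun i : Q => x i :=
      funext fun i => if_neg fun h => (hPQ i).1 h i.2
    simp only [extend, Matrix.of_apply]
    rw [hP, hQ, if_pos fun i hi => by rw [if_neg hi],
      if_pos fun i hi => by rw [if_pos ((hPQ i).2 hi)], mul_one, mul_one]
  · intro z _ hz
    obtain ⟨i, hi⟩ := Function.ne_iff.1 hz
    simp only [extend, Matrix.of_apply]
    by_cases hiP : i ∈ P
    · rw [if_neg (c := ∀ i, i ∉ Q → z i = y i), mul_zero, mul_zero]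
      rw [if_pos hiP] at hi
      exact fun h => hi (h i ((hPQ i).1 hiP))
    · rw [if_neg (c := ∀ i, i ∉ P → x i = z i), mul_zero, zero_mul]
      rw [if_neg hiP] at hi
      exact fun h => hi (h i hiP).symm
  · exact fun h => absurd (Finset.mem_univ _) h

/-- Operators of the two sides of a bipartition commute. -/
theorem extend_mul_extend_comm {P Q : Finset ι} (hPQ : ∀ i, i ∈ P ↔ i ∉ Q) (A : LocalMatrix d P)
    (B : LocalMatrix d Q) : extend A * extend B = extend B * extend A := by
  ext x y
  rw [extend_mul_extend_apply hPQ, extend_mul_extend_apply fun i => by rw [hPQ, not_not], mul_comm]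

theorem toEuclideanLin_mul_apply {α : Type} [Fintype α] [DecidableEq α] (F G : Matrix α α ℂ)
    (φ : EuclideanSpace ℂ α) :
    Matrix.toEuclideanLin (F * G) φ = Matrix.toEuclideanLin F (Matrix.toEuclideanLin G φ) := by
  simp [Matrix.toLpLin_apply]

theorem inner_toEuclideanLin {α : Type} [Fintype α] [DecidableEq α] (F G : Matrix α α ℂ)
    (ψ φ : EuclideanSpace ℂ α) :
    inner ℂ (Matrix.toEuclideanLin F ψ) (Matrix.toEuclideanLin G φ) =
      inner ℂ ψ (Matrix.toEuclideanLin (F.conjTranspose * G) φ) := by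
  rw [toEuclideanLin_mul_apply, Matrix.toEuclideanLin_conjTranspose_eq_adjoint,
    LinearMap.adjoint_inner_right]

theorem inner_localOp (M : LocalMatrix d T) (ψ φ : State d) :
    inner ℂ (localOp M ψ) (localOp M φ) =
      inner ℂ ψ (Matrix.toEuclideanLin (extend (M.conjTranspose * M)) φ) := by
  rw [localOp, inner_toEuclideanLin, extend_mul, extend_conjTranspose]

theorem inner_localOp_of_eq_smul_one {M : LocalMatrix d T} {c : ℂ}
    (hM : M.conjTranspose * M = c • 1) (ψ φ : State d) :
    inner ℂ (localOp M ψ) (localOp M φ) = c * inner ℂ ψ φ := by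
  have h1 : Matrix.toEuclideanLin (1 : Matrix (∀ i, Fin (d i)) (∀ i, Fin (d i)) ℂ) φ = φ := by
    simp
  rw [inner_localOp, hM, extend_smul_one, map_smul, LinearMap.smul_apply, h1, inner_smul_right]

theorem localOp_mul (M N : LocalMatrix d T) (ψ : State d) :
    localOp (M * N) ψ = localOp M (localOp N ψ) := by
  rw [localOp, extend_mul, toEuclideanLin_mul_apply]
  rfl

theorem localOp_comm {P Q : Finset ι} (hPQ : ∀ i, i ∈ P ↔ i ∉ Q) (A : LocalMatrix d P)
    (B : LocalMatrix d Q) (ψ : State d) :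
    localOp A (localOp B ψ) = localOp B (localOp A ψ) := by
  rw [localOp, localOp, ← toEuclideanLin_mul_apply, extend_mul_extend_comm hPQ,
    toEuclideanLin_mul_apply]

end LocalOperators

/-! ### Nonlocality -/

section Nonlocality

variable {d : Fin 4 → ℕ}

theorem actsTriviallyOn_extend {T : Finset (Fin 4)} {X : Fin 4} (hX : X ∉ T)
    (M : LocalMatrix d T) : ActsTriviallyOn (extend M) X where
  entry_eq_zero x y hxy := by
    rw [extend, Matrix.of_apply, if_neg fun h => hxy (h X hX), mul_zero]
  entry_update x y z hxy := by
    have hupd : ∀ x : ∀ i, Fin (d i),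
        (fun i : T => Function.update x X z i) = fun i : T => x i := fun x =>
      funext fun i => Function.update_of_ne (fun h : (i : Fin 4) = X => hX (h ▸ i.2)) _ _
    have hiff : (∀ i, i ∉ T → Function.update x X z i = Function.update y X z i) ↔
        ∀ i, i ∉ T → x i = y i := by
      refine forall_congr' fun i => imp_congr_right fun _ => ?_
      rcases eq_or_ne i X with rfl | hi
      · simp [hxy]
      · simp [hi]
    simp only [extend, Matrix.of_apply, hupd, hiff]
    congr

theorem conjTranspose_mul_self_eq_smul_one (hd : ∀ i, 3 ≤ d i) {T : Finset (Fin 4)}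
    (hT : T ≠ Finset.univ) (M : LocalMatrix d T)
    (hM : (fourPartySet d).Pairwise fun ψ φ => inner ℂ (localOp M ψ) (localOp M φ) = 0) :
    ∃ c : ℂ, M.conjTranspose * M = c • 1 := by
  obtain ⟨X, hX⟩ : ∃ X, X ∉ T := by
    by_contra! h
    exact hT (Finset.eq_univ_iff_forall.2 h)
  obtain ⟨c, hc⟩ := exists_eq_smul_one (F := extend (M.conjTranspose * M)) hd
    (fun ψ hψ φ hφ hne => (inner_localOp M ψ φ).symm.trans (hM hψ hφ hne))
    (actsTriviallyOn_extend hX _)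
  exact ⟨c, extend_injective (fun i => by have := hd i; omega) (by rw [hc, extend_smul_one])⟩

theorem fourPartySet_isStrongestNonlocal (hd : ∀ i, 3 ≤ d i) :
    IsStrongestNonlocal (fourPartySet d) := fun _ _ hT _ M _ hO k =>
  conjTranspose_mul_self_eq_smul_one hd hT (M k) fun ψ hψ φ hφ hne =>
    hO k (i := ⟨ψ, hψ⟩) (j := ⟨φ, hφ⟩) fun h => hne (congrArg Subtype.val h)

/-- What is left of the set after outcomes of orthogonality-preserving measurements: either all the
states have been eliminated, or the states have been transformed by multiples `A`, `B` of
isometries of the two sides. In the latter case a further measurement `M` on one side amounts to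
the measurement `M * A` or `M * B` of the original set. -/
theorem eq_zero_or_exists_of_reachable (hd : ∀ i, 3 ≤ d i) {T : Finset (Fin 4)}
    (hT : T.Nonempty) (hT' : T ≠ Finset.univ) {φ : fourPartySet d → State d}
    (hφ : Reachable T (fun ψ : fourPartySet d => (ψ : State d)) φ) :
    (∀ j, φ j = 0) ∨ ∃ (A : LocalMatrix d T) (B : LocalMatrix d Tᶜ) (a b : ℂ), a ≠ 0 ∧ b ≠ 0 ∧
      A.conjTranspose * A = a • 1 ∧ B.conjTranspose * B = b • 1 ∧
      ∀ j, φ j = localOp A (localOp B (j : State d)) := by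
  have hTc : Tᶜ ≠ Finset.univ := by
    rw [Ne, Finset.compl_eq_univ_iff]
    exact hT.ne_empty
  have hcomm : ∀ i, i ∈ T ↔ i ∉ Tᶜ := fun i => by simp
  induction hφ with
  | start =>
    have h1 : ∀ (P : Finset (Fin 4)) (ψ : State d), localOp (1 : LocalMatrix d P) ψ = ψ := by
      intro P ψ
      have := extend_smul_one (d := d) (T := P) 1
      rw [one_smul, one_smul] at this
      simp [localOp, this]
    exact Or.inr ⟨1, 1, 1, 1, one_ne_zero, one_ne_zero, by simp, by simp, fun j => by simp [h1]⟩
  | @measure φ hφ P hP m M hM hO k ih =>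
    rcases ih with h0 | ⟨A, B, a, b, ha, hb, hA, hB, hAB⟩
    · exact Or.inl fun j => (congrArg (localOp (M k)) (h0 j)).trans (map_zero _)
    · rcases hP with rfl | rfl
      · have hφ' : ∀ j, localOp (M k) (φ j) = localOp B (localOp (M k * A) (j : State d)) :=
          fun j => by rw [hAB, ← localOp_mul, localOp_comm hcomm]
        obtain ⟨c, hc⟩ := conjTranspose_mul_self_eq_smul_one hd hT' (M k * A) <| by
          intro ψ hψ χ hχ hne
          have h : inner ℂ (localOp (M k) (φ ⟨ψ, hψ⟩)) (localOp (M k) (φ ⟨χ, hχ⟩)) = 0 :=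
            hO k fun h => hne (congrArg Subtype.val h)
          rw [hφ', hφ', inner_localOp_of_eq_smul_one hB] at h
          exact (mul_eq_zero.1 h).resolve_left hb
        rcases eq_or_ne c 0 with rfl | hc0
        · refine Or.inl fun j => (hφ' j).trans ?_
          rw [← inner_self_eq_zero (𝕜 := ℂ), inner_localOp_of_eq_smul_one hB,
            inner_localOp_of_eq_smul_one hc, zero_mul, mul_zero]
        · exact Or.inr ⟨M k * A, B, c, b, hc0, hb, hc, hB, fun j =>
            (hφ' j).trans (localOp_comm hcomm _ _ _).symm⟩
      · have hφ' : ∀ j, localOp (M k) (φ j) = localOp A (localOp (M k * B) (j : State d)) :=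
          fun j => by rw [hAB, ← localOp_comm hcomm, ← localOp_mul]
        obtain ⟨c, hc⟩ := conjTranspose_mul_self_eq_smul_one hd hTc (M k * B) <| by
          intro ψ hψ χ hχ hne
          have h : inner ℂ (localOp (M k) (φ ⟨ψ, hψ⟩)) (localOp (M k) (φ ⟨χ, hχ⟩)) = 0 :=
            hO k fun h => hne (congrArg Subtype.val h)
          rw [hφ', hφ', inner_localOp_of_eq_smul_one hA] at h
          exact (mul_eq_zero.1 h).resolve_left ha
        rcases eq_or_ne c 0 with rfl | hc0
        · refine Or.inl fun j => (hφ' j).trans ?_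
          rw [← inner_self_eq_zero (𝕜 := ℂ), inner_localOp_of_eq_smul_one hA,
            inner_localOp_of_eq_smul_one hc, zero_mul, mul_zero]
        · exact Or.inr ⟨A, M k * B, a, c, ha, hc0, hA, hc, hφ'⟩

theorem fourPartySet_isStronglyNonlocal (hd : ∀ i, 3 ≤ d i) :
    IsStronglyNonlocal (fourPartySet d) := by
  intro T hT hT' φ hφ i j hi
  rcases eq_zero_or_exists_of_reachable hd hT hT' hφ with h0 | ⟨A, B, a, b, ha, hb, hA, hB, hAB⟩
  · exact h0 j
  · have hne := ((fourPartySet_isOrthogonalProductSet hd).1 i i.2).1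
    rw [← inner_self_eq_zero (𝕜 := ℂ), hAB, inner_localOp_of_eq_smul_one hA,
      inner_localOp_of_eq_smul_one hB] at hi
    simp [ha, hb, hne] at hi

end Nonlocality

end Multipartite

theorem theorem2 (d : Fin 4 → ℕ) (hd : ∀ i, 3 ≤ d i) :
    -- the blocks come from a decomposition of the outermost layer of the hypercube
    ((Pairwise fun a b => Disjoint (Multipartite.cell d (Multipartite.pattern a))
        (Multipartite.cell d (Multipartite.pattern b))) ∧
      (⋃ b, Multipartite.cell d (Multipartite.pattern b)) = Multipartite.outermostLayer d ∧
      ∀ b, Submodule.span ℂ (Multipartite.block d (Multipartite.pattern b)) =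
        Multipartite.basisSpan d (Multipartite.cell d (Multipartite.pattern b))) ∧
    Multipartite.IsOrthogonalProductSet (Multipartite.fourPartySet d) ∧
    Multipartite.IsStrongestNonlocal (Multipartite.fourPartySet d) ∧
    Multipartite.IsStronglyNonlocal (Multipartite.fourPartySet d) ∧
    ((Multipartite.fourPartySet d).ncard : ℤ) =
      (d 0 : ℤ) * d 1 * d 2 * d 3 -
        ((d 0 : ℤ) - 2) * ((d 1 : ℤ) - 2) * ((d 2 : ℤ) - 2) * ((d 3 : ℤ) - 2) := by
  refine ⟨⟨fun a b hab => Multipartite.disjoint_cells hd hab, Multipartite.iUnion_cell hd,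
    fun b => Multipartite.span_block _⟩, Multipartite.fourPartySet_isOrthogonalProductSet hd,
    Multipartite.fourPartySet_isStrongestNonlocal hd,
    Multipartite.fourPartySet_isStronglyNonlocal hd, ?_⟩
  rw [Multipartite.ncard_fourPartySet_eq_ncard hd, Multipartite.ncard_outermostLayer hd]
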